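/- Let $r\ge 1$ and let $\Gamma$ be an extra-special $2$-group of order $2^{2r+1}$, that is, a finite group of this order whose center $Z(\Gamma)$ is isomorphic to $\mathbb{Z}/2$ and whose quotient $\Gamma/Z(\Gamma)$ is a direct product of copies of $\mathbb{Z}/2$. Let $1\to\Gamma\to G'\xrightarrow{q}G\to 1$ be a short exact sequence of groups, let $\alpha,\beta\in G$ be commuting elements, and let $$L(\alpha,\beta,q)=\{(a,b)\in G'\times G' \mid q(a)=\alpha,\ q(b)=\beta,\ ab=ba\}.$$ The group $G$ acts on the one-dimensional complex representations $\chi:\Gamma\to\mathbb{C}^\times$ by $(\chi\cdot g)(\gamma)=\chi(\tilde g\gamma\tilde g^{-1})$, where $\tilde g\in q^{-1}(g)$ is arbitrary. Let $N$ be the number of non-trivial one-dimensional representations of $\Gamma$ that are fixed by the action of the subgroup of $G$ generated by $\alpha$ and $\beta$ (so, if $\alpha$ and $\beta$ generate $G$, the number of those fixed by $G$). Then $L(\alpha,\beta,q)$ is finite and either $|L(\alpha,\beta,q)|=0$ or $$|L(\alpha,\beta,q)|=2^{2r+1}(1+N+1)\quad\text{or}\quad |L(\alpha,\beta,q)|=2^{2r+1}(1+N-1).$$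 -/

import Mathlib

universe u v w

/-- A finite group `Γ` is extra-special (for the prime `p`) if its order is a power of `p`, its
center is isomorphic to `ℤ/p`, and `Γ / Z(Γ)` is a direct product of copies of `ℤ/p`. -/
structure IsExtraSpecial (p : ℕ) (Γ : Type u) [Group Γ] : Prop where
  prime : p.Prime
  finite : Finite Γ
  card_eq_pow : ∃ n : ℕ, Nat.card Γ = p ^ n
  center_equiv : Nonempty (Subgroup.center Γ ≃* Multiplicative (ZMod p))
  quotient_equiv : ∃ m : ℕ, Nonempty (Γ ⧸ Subgroup.center Γ ≃* (Fin m → Multiplicative (ZMod p)))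

namespace GroupExtension

variable {Γ : Type u} {G' : Type v} {G : Type w} [Group Γ] [Group G'] [Group G]

/-- The set `L(α, β, q)` of pairs of commuting elements of `G'` projecting to `α` and `β`. -/
def commutingLifts (S : GroupExtension Γ G' G) (α β : G) : Set (G' × G') :=
  {x | S.rightHom x.1 = α ∧ S.rightHom x.2 = β ∧ x.1 * x.2 = x.2 * x.1}

/-- The one-dimensional representation `γ ↦ χ (a γ a⁻¹)` of `Γ`, for `a : G'`. -/
noncomputable def conjChar (S : GroupExtension Γ G' G) (a : G') (χ : Γ →* ℂˣ) : Γ →* ℂˣ :=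
  χ.comp (S.conjAct a).toMonoidHom

/-- `conjChar S a χ` depends only on the image of `a` in `G`, so that it defines an action of `G`
on the one-dimensional representations of `Γ`. -/
theorem conjChar_eq_of_rightHom_eq (S : GroupExtension Γ G' G) {a b : G'}
    (h : S.rightHom a = S.rightHom b) (χ : Γ →* ℂˣ) : S.conjChar a χ = S.conjChar b χ := by
  have hm : b⁻¹ * a ∈ S.inl.range := by
    rw [S.range_inl_eq_ker_rightHom, MonoidHom.mem_ker, map_mul, map_inv, h, inv_mul_cancel]
  obtain ⟨n, hn⟩ := hm
  have ha : a = b * S.inl n := by rw [hn, mul_inv_cancel_left]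
  ext γ
  have key : S.conjAct a γ = S.conjAct b (n * γ * n⁻¹) := by
    apply S.inl_injective
    rw [S.inl_conjAct_comm, S.inl_conjAct_comm, ha]
    simp only [map_mul, map_inv, mul_inv_rev, mul_assoc]
  have : χ (S.conjAct a γ) = χ (S.conjAct b γ) := by
    rw [key]
    simp only [map_mul, map_inv]
    rw [mul_comm (χ (S.conjAct b n)), mul_inv_cancel_right]
  exact congrArg Units.val this

/-- The non-trivial one-dimensional complex representations of `Γ` (homomorphisms
`Γ → ℂˣ = GL₁(ℂ)`) that are fixed by the action of every element of the subgroup `H` of `G`.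
For one-dimensional representations, equivalence is equality. -/
def fixedNontrivialChars (S : GroupExtension Γ G' G) (H : Subgroup G) : Set (Γ →* ℂˣ) :=
  {χ | χ ≠ 1 ∧ ∀ a : G', S.rightHom a ∈ H → S.conjChar a χ = χ}

end GroupExtension

/-!
Fix commuting lifts `a` and `b` of `α` and `β`, acting on `Γ` by conjugation as `A` and `B`. The
other lifts are `x a` and `y b` with `(x, y) ∈ Γ × Γ`, and they commute if and only if
`f (x, y) = x (A y) (B x)⁻¹ y⁻¹` is trivial. Let `ε` be `1` at `1`, `-1` at the other central
element of `Γ` and `0` off the center. Then `2 |L| = ∑ ε(f p)² + ∑ ε(f p)`.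

On `Γ × Γ` the function `ε ∘ f` is a degenerate analogue of a quadratic form with values in `±1`:
`ε(f p) ε(f (p q)) = ε(f p)² ε(f q) b(p, q)` for a bimultiplicative `b`. Moreover `ε(f p)²` is the
indicator function of the annihilator under `b` of the elements `δ v = (v (A v)⁻¹, v (B v)⁻¹)`, and
`f (δ v) = 1` because the lifts `δ v` stands for are the conjugates of `a` and `b` by `v`. Hence
the Gauss sum `∑ ε(f p)` has square `(2 |Γ|)²`. The sum `∑ ε(f p)²` is `|Γ|` times the number of
`v` with `δ v` central; the character `[v, -]` of `Γ` runs twice through all the one-dimensional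
representations, and `δ v` is central if and only if that character is fixed by `A` and `B`. So
`∑ ε(f p)² = 2 |Γ| (N + 1)`.
-/

section CentralSign

variable {Γ : Type*} [Group Γ]

open Classical in
/-- The class function of `Γ` equal to `1` at `1`, to `-1` at the other central elements and to `0`
off the center. If `Γ` is an extra-special `2`-group, it is the character of the faithful
irreducible representation of `Γ` divided by its degree. -/
noncomputable def centralSign (g : Γ) : ℤ :=
  if g = 1 then 1 else if g ∈ Subgroup.center Γ then -1 else 0

theorem centralSign_eq_one_iff {g : Γ} : centralSign g = 1 ↔ g = 1 := by
  unfold centralSign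
  split_ifs <;> simp_all

@[simp]
theorem centralSign_one : centralSign (1 : Γ) = 1 :=
  centralSign_eq_one_iff.mpr rfl

theorem centralSign_of_notMem_center {g : Γ} (hg : g ∉ Subgroup.center Γ) :
    centralSign g = 0 := by
  have hg1 : g ≠ 1 := fun h => hg (h ▸ one_mem _)
  simp [centralSign, hg, hg1]

theorem centralSign_sq_of_mem_center {g : Γ} (hg : g ∈ Subgroup.center Γ) :
    centralSign g ^ 2 = 1 := by
  unfold centralSign
  split_ifs <;> rfl

theorem centralSign_sq_add_centralSign [DecidableEq Γ] (g : Γ) :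
    centralSign g ^ 2 + centralSign g = if g = 1 then 2 else 0 := by
  unfold centralSign
  split_ifs <;> simp_all

theorem centralSign_inv (g : Γ) : centralSign g⁻¹ = centralSign g := by
  classical exact if_congr inv_eq_one rfl (if_congr inv_mem_iff rfl rfl)

theorem centralSign_map {Γ' : Type*} [Group Γ'] (A : Γ ≃* Γ') (g : Γ) :
    centralSign (A g) = centralSign g := by
  classical
  exact if_congr (map_eq_one_iff A A.injective) rfl
    (if_congr (MulEquivClass.apply_mem_center_iff A) rfl rfl)

theorem centralSign_mul_comm (g h : Γ) : centralSign (g * h) = centralSign (h * g) := by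
  rw [← centralSign_map (MulAut.conj h) (g * h), MulAut.conj_apply]
  group

theorem eq_of_mem_center_of_ne_one (hZ : Nat.card (Subgroup.center Γ) = 2) {g h : Γ}
    (hg : g ∈ Subgroup.center Γ) (hh : h ∈ Subgroup.center Γ) (hg1 : g ≠ 1) (hh1 : h ≠ 1) :
    g = h := by
  obtain ⟨z, -, hz⟩ := (Nat.card_eq_two_iff' (1 : Subgroup.center Γ)).mp hZ
  have hgz := hz ⟨g, hg⟩ (by simpa using hg1)
  have hhz := hz ⟨h, hh⟩ (by simpa using hh1)
  exact congrArg Subtype.val (hgz.trans hhz.symm)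

theorem map_eq_of_mem_center (hZ : Nat.card (Subgroup.center Γ) = 2) (A : MulAut Γ) {g : Γ}
    (hg : g ∈ Subgroup.center Γ) : A g = g := by
  by_cases hg1 : g = 1
  · rw [hg1, map_one]
  · exact eq_of_mem_center_of_ne_one hZ ((MulEquivClass.apply_mem_center_iff A).mpr hg) hg
      ((map_ne_one_iff A A.injective).mpr hg1) hg1

theorem centralSign_mul_of_mem_center (hZ : Nat.card (Subgroup.center Γ) = 2) {g : Γ}
    (hg : g ∈ Subgroup.center Γ) (h : Γ) :
    centralSign (g * h) = centralSign g * centralSign h := by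
  by_cases hh : h ∈ Subgroup.center Γ
  · by_cases hg1 : g = 1
    · simp [hg1]
    by_cases hh1 : h = 1
    · simp [hh1]
    have hgg : g * g = 1 := by
      have := pow_card_eq_one' (x := (⟨g, hg⟩ : Subgroup.center Γ))
      rw [hZ] at this
      simpa [sq] using congrArg Subtype.val this
    obtain rfl := eq_of_mem_center_of_ne_one hZ hg hh hg1 hh1
    rw [hgg, centralSign_one, ← sq, centralSign_sq_of_mem_center hg]
  · have hgh : g * h ∉ Subgroup.center Γ := fun H => hh ((mul_mem_cancel_left hg).mp H)
    rw [centralSign_of_notMem_center hh, centralSign_of_notMem_center hgh, mul_zero]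

theorem centralSign_mul_mul_mul (hZ : Nat.card (Subgroup.center Γ) = 2) (p g q : Γ) :
    centralSign (p * q) * centralSign (p * g * q) = centralSign (p * q) ^ 2 * centralSign g := by
  have hcycle : centralSign (p * g * q) = centralSign (q * p * g) := by
    rw [mul_assoc, centralSign_mul_comm, mul_assoc, centralSign_mul_comm, mul_assoc,
      centralSign_mul_comm, mul_assoc]
  rw [centralSign_mul_comm p q, hcycle]
  by_cases hqp : q * p ∈ Subgroup.center Γ
  · rw [centralSign_mul_of_mem_center hZ hqp]
    ring
  · rw [centralSign_of_notMem_center hqp]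
    ring

end CentralSign

section IntValued

variable {P : Type*} [Group P]

theorem map_mul_map_self_int (f : P →* ℤ) (p : P) : f p * f p = 1 :=
  congrArg Units.val (Int.units_mul_self (f.toHomUnits p))

theorem map_inv_int (f : P →* ℤ) (p : P) : f p⁻¹ = f p := by
  calc f p⁻¹ = f p⁻¹ * (f p * f p) := by rw [map_mul_map_self_int, mul_one]
    _ = f p := by rw [← mul_assoc, ← map_mul, inv_mul_cancel, map_one, one_mul]

theorem sum_sum_pairing_eq_card_mul_card {H : Type*} [Fintype P] [Fintype H]
    (b : P →* P →* ℤ) (δ : H → P) :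
    ∑ p, ∑ h, b p (δ h) = Fintype.card P * Nat.card {h // b.flip (δ h) = 1} := by
  classical
  rw [Finset.sum_comm, Nat.card_eq_fintype_card, Fintype.card_subtype, Finset.card_filter,
    Nat.cast_sum, Finset.mul_sum]
  refine Finset.sum_congr rfl fun h _ => ?_
  rw [Nat.cast_ite, Nat.cast_one, Nat.cast_zero, mul_ite, mul_one, mul_zero]
  exact mod_cast sum_hom_units (b.flip (δ h))

/-- Summing `F p * F (p * q) = F p ^ 2 * (F q * b p q)` over `p` and `q`, the Fourier expansion of
`F p ^ 2` and the orthogonality relations for `b` leave only the `q` in `δ h * b.flip.ker`. -/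
theorem sq_sum_of_quadratic {H : Type*} [Fintype P] [Fintype H] [Nonempty H] (b : P →* P →* ℤ)
    {F : P → ℤ} {δ : H → P} (hquad : ∀ p q, F p * F (p * q) = F p ^ 2 * (F q * b p q))
    (hsq : ∀ p, Fintype.card H * F p ^ 2 = ∑ h, b p (δ h))
    (hδ : ∀ h, ∀ r ∈ b.flip.ker, F (δ h * r) = 1) :
    (∑ p, F p) ^ 2 = Fintype.card P * Nat.card b.flip.ker := by
  classical
  have sum_pairing (q : P) : ∑ p, b p q = if b.flip q = 1 then (Fintype.card P : ℤ) else 0 :=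
    mod_cast sum_hom_units (b.flip q)
  have pairing_conj (h : H) (p r : P) : b p (δ h * r) * b p (δ h) = b p r := by
    rw [map_mul, mul_right_comm, map_mul_map_self_int, one_mul]
  have sum_shift (h : H) :
      ∑ q, F q * ∑ p, b p q * b p (δ h) = Fintype.card P * Nat.card b.flip.ker := by
    rw [← Equiv.sum_comp (Equiv.mulLeft (δ h))]
    simp only [Equiv.coe_mulLeft, pairing_conj, sum_pairing]
    calc ∑ r, F (δ h * r) * (if b.flip r = 1 then (Fintype.card P : ℤ) else 0)
        = ∑ r, if r ∈ b.flip.ker then (Fintype.card P : ℤ) else 0 := by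
          refine Finset.sum_congr rfl fun r _ => ?_
          by_cases hr : r ∈ b.flip.ker
          · rw [hδ h r hr, if_pos hr, if_pos (MonoidHom.mem_ker.mp hr), one_mul]
          · rw [if_neg hr, if_neg (mt MonoidHom.mem_ker.mpr hr), mul_zero]
      _ = Fintype.card P * Nat.card b.flip.ker := by
          rw [← Finset.sum_filter, Finset.sum_const, nsmul_eq_mul, mul_comm,
            Nat.card_eq_fintype_card, ← Fintype.card_subtype]
  refine mul_left_cancel₀ (Nat.cast_ne_zero.mpr (Fintype.card_ne_zero (α := H))) ?_
  calc (Fintype.card H : ℤ) * (∑ p, F p) ^ 2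
      = ∑ p, ∑ q, Fintype.card H * (F p * F (p * q)) := by
        simp only [← Finset.mul_sum, Equiv.sum_comp (Equiv.mulLeft _) F, ← Equiv.coe_mulLeft]
        rw [← Finset.sum_mul, sq]
    _ = ∑ p, ∑ q, ∑ h, F q * (b p q * b p (δ h)) := by
        refine Finset.sum_congr rfl fun p _ => Finset.sum_congr rfl fun q _ => ?_
        rw [hquad, ← mul_assoc, hsq, Finset.sum_mul]
        exact Finset.sum_congr rfl fun h _ => by ring
    _ = ∑ h, ∑ q, F q * ∑ p, b p q * b p (δ h) := by
        simp only [Finset.mul_sum]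
        rw [Finset.sum_comm, Finset.sum_congr rfl fun q _ => Finset.sum_comm, Finset.sum_comm]
    _ = Fintype.card H * (Fintype.card P * Nat.card b.flip.ker) := by
        simp only [sum_shift, Finset.sum_const, Finset.card_univ, nsmul_eq_mul]

end IntValued

open scoped commutatorElement in
/-- `Γ` has a center of order two that contains all commutators. Among finite groups these are the
group of order two and the extra-special `2`-groups. -/
structure IsWeaklyExtraSpecial (Γ : Type*) [Group Γ] : Prop where
  card_center : Nat.card (Subgroup.center Γ) = 2
  commutatorElement_mem_center (x y : Γ) : ⁅x, y⁆ ∈ Subgroup.center Γ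

namespace IsWeaklyExtraSpecial

open scoped commutatorElement

variable {Γ : Type*} [Group Γ]

theorem center_ne_top (hΓ : IsWeaklyExtraSpecial Γ) (hcard : Nat.card Γ ≠ 2) :
    Subgroup.center Γ ≠ ⊤ := by
  intro h
  have := hΓ.card_center
  rw [h, Subgroup.card_top] at this
  exact hcard this

theorem centralSign_commutatorElement_comm (x y : Γ) : centralSign ⁅x, y⁆ = centralSign ⁅y, x⁆ := by
  rw [← commutatorElement_inv, centralSign_inv]

theorem centralSign_commutatorElement_mul_left (hΓ : IsWeaklyExtraSpecial Γ) (x x' y : Γ) :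
    centralSign ⁅x * x', y⁆ = centralSign ⁅x, y⁆ * centralSign ⁅x', y⁆ := by
  have hx'y := hΓ.commutatorElement_mem_center x' y
  have hmul : ⁅x * x', y⁆ = ⁅x', y⁆ * ⁅x, y⁆ := by
    calc ⁅x * x', y⁆ = x * ⁅x', y⁆ * x⁻¹ * ⁅x, y⁆ := by
          simp only [commutatorElement_def]
          group
      _ = ⁅x', y⁆ * ⁅x, y⁆ := by
          rw [Subgroup.mem_center_iff.mp hx'y x, mul_inv_cancel_right]
  rw [hmul, centralSign_mul_of_mem_center hΓ.card_center hx'y, mul_comm]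

theorem centralSign_commutatorElement_mul_right (hΓ : IsWeaklyExtraSpecial Γ) (x y y' : Γ) :
    centralSign ⁅x, y * y'⁆ = centralSign ⁅x, y⁆ * centralSign ⁅x, y'⁆ := by
  simp only [centralSign_commutatorElement_comm x, hΓ.centralSign_commutatorElement_mul_left]

/-- The commutator pairing of `Γ`: its value at `(x, y)` is `1` if `x` and `y` commute and `-1`
otherwise. -/
noncomputable def commutatorPairing (hΓ : IsWeaklyExtraSpecial Γ) : Γ →* Γ →* ℤ where
  toFun x :=
    { toFun y := centralSign ⁅x, y⁆
      map_one' := by simp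
      map_mul' := hΓ.centralSign_commutatorElement_mul_right x }
  map_one' := by ext; simp
  map_mul' x x' := by ext y; exact hΓ.centralSign_commutatorElement_mul_left x x' y

theorem commutatorPairing_apply (hΓ : IsWeaklyExtraSpecial Γ) (x y : Γ) :
    hΓ.commutatorPairing x y = centralSign ⁅x, y⁆ :=
  rfl

theorem commutatorPairing_comm (hΓ : IsWeaklyExtraSpecial Γ) (x y : Γ) :
    hΓ.commutatorPairing x y = hΓ.commutatorPairing y x :=
  centralSign_commutatorElement_comm x y

theorem commutatorPairing_map (hΓ : IsWeaklyExtraSpecial Γ) (A : MulAut Γ) (x y : Γ) :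
    hΓ.commutatorPairing (A x) (A y) = hΓ.commutatorPairing x y := by
  rw [commutatorPairing_apply, ← map_commutatorElement, centralSign_map, commutatorPairing_apply]

theorem ker_commutatorPairing (hΓ : IsWeaklyExtraSpecial Γ) :
    hΓ.commutatorPairing.ker = Subgroup.center Γ := by
  ext x
  simp only [MonoidHom.mem_ker, Subgroup.mem_center_iff, DFunLike.ext_iff, MonoidHom.one_apply,
    commutatorPairing_apply, centralSign_eq_one_iff, commutatorElement_eq_one_iff_mul_comm]
  exact forall_congr' fun y => eq_comm

theorem sum_commutatorPairing [Fintype Γ] (hΓ : IsWeaklyExtraSpecial Γ) (g : Γ) :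
    ∑ v, hΓ.commutatorPairing g v = Fintype.card Γ * centralSign g ^ 2 := by
  classical
  have hg : hΓ.commutatorPairing g = 1 ↔ g ∈ Subgroup.center Γ := by
    rw [← MonoidHom.mem_ker, ker_commutatorPairing]
  rw [sum_hom_units]
  split_ifs with h
  · rw [centralSign_sq_of_mem_center (hg.mp h), mul_one]
  · simp [centralSign_of_notMem_center (mt hg.mpr h)]

theorem centralSign_mul_swap (hΓ : IsWeaklyExtraSpecial Γ) (p x y q : Γ) :
    centralSign (p * (x * y) * q) =
      hΓ.commutatorPairing x y * centralSign (p * (y * x) * q) := by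
  have hxy := hΓ.commutatorElement_mem_center x y
  have hswap : p * (x * y) * q = ⁅x, y⁆ * (p * (y * x) * q) := by
    calc p * (x * y) * q = p * ⁅x, y⁆ * (y * x * q) := by
          rw [commutatorElement_def]
          group
      _ = ⁅x, y⁆ * (p * (y * x) * q) := by
          simp only [Subgroup.mem_center_iff.mp hxy p, mul_assoc]
  rw [hswap, centralSign_mul_of_mem_center hΓ.card_center hxy, commutatorPairing_apply]

section Characters

/-- The homomorphism from `Γ` to its group of one-dimensional complex representations given by the
commutator pairing. -/
noncomputable def commutatorChar (hΓ : IsWeaklyExtraSpecial Γ) : Γ →* Γ →* ℂˣ where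
  toFun v := ((Int.castRingHom ℂ : ℤ →* ℂ).comp (hΓ.commutatorPairing v)).toHomUnits
  map_one' := by ext; simp
  map_mul' v w := by ext; simp

theorem ker_commutatorChar (hΓ : IsWeaklyExtraSpecial Γ) :
    hΓ.commutatorChar.ker = Subgroup.center Γ := by
  rw [← hΓ.ker_commutatorPairing]
  ext v
  simp [MonoidHom.mem_ker, DFunLike.ext_iff, commutatorChar, Units.ext_iff]

theorem commutator_eq_center (hΓ : IsWeaklyExtraSpecial Γ) (hna : Subgroup.center Γ ≠ ⊤) :
    commutator Γ = Subgroup.center Γ := by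
  have hle : commutator Γ ≤ Subgroup.center Γ :=
    Subgroup.commutator_le.mpr fun x _ y _ => hΓ.commutatorElement_mem_center x y
  have hne : commutator Γ ≠ ⊥ := mt (commutator_eq_bot_iff_center_eq_top Γ).mp hna
  obtain ⟨⟨c, hc⟩, hc1⟩ := Subgroup.ne_bot_iff_exists_ne_one.mp hne
  refine le_antisymm hle fun g hg => ?_
  by_cases hg1 : g = 1
  · exact hg1 ▸ one_mem _
  · rwa [eq_of_mem_center_of_ne_one hΓ.card_center hg (hle hc) hg1 (by simpa using hc1)]

theorem commutatorChar_surjective [Finite Γ] (hΓ : IsWeaklyExtraSpecial Γ)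
    (hna : Subgroup.center Γ ≠ ⊤) : Function.Surjective hΓ.commutatorChar := by
  have card_chars : Nat.card (Γ →* ℂˣ) = (Subgroup.center Γ).index := by
    rw [Nat.card_congr Abelianization.lift,
      CommGroup.card_monoidHom_of_hasEnoughRootsOfUnity (Abelianization Γ) ℂ,
      ← hΓ.commutator_eq_center hna]
    rfl
  rw [← MonoidHom.range_eq_top]
  apply Subgroup.eq_top_of_card_eq
  rw [← Subgroup.index_ker, ker_commutatorChar, card_chars]

end Characters

end IsWeaklyExtraSpecial

theorem card_comap_of_surjective {H K : Type*} [Group H] [Group K] {f : H →* K}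
    (hf : Function.Surjective f) (L : Subgroup K) :
    Nat.card (L.comap f) = Nat.card f.ker * Nat.card L := by
  rw [← Subgroup.relIndex_bot_left, ← Subgroup.relIndex_mul_relIndex ⊥ f.ker _ bot_le
    (MonoidHom.ker_le_comap f L), Subgroup.relIndex_bot_left, Subgroup.relIndex_ker,
    Subgroup.map_comap_eq_self_of_surjective hf]

section TwistedCommutator

variable {Γ : Type*} [Group Γ]

/-- The subgroup of one-dimensional complex representations of `Γ` fixed by the automorphism `A`. -/
noncomputable def fixedChars (A : MulAut Γ) : Subgroup (Γ →* ℂˣ) :=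
  (MonoidHom.compHom' A.toMonoidHom).eqLocus (MonoidHom.id _)

theorem mem_fixedChars_iff {A : MulAut Γ} {χ : Γ →* ℂˣ} :
    χ ∈ fixedChars A ↔ χ.comp A.toMonoidHom = χ :=
  Iff.rfl

/-- For `a b : G'` over `α` and `β` acting on `Γ` by conjugation as `A` and `B`, this is the
commutator of the lifts `p.1 * a` and `p.2 * b`, if `a` and `b` commute. -/
def twistedCommutator (A B : MulAut Γ) (p : Γ × Γ) : Γ :=
  p.1 * A p.2 * (p.2 * B p.1)⁻¹

/-- The pairs `p` for which the lifts `p.1 * a` and `p.2 * b` are the conjugates of `a` and `b` by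
an element `v` of `Γ`, where `A` and `B` are conjugation by `a` and `b`. -/
def twistedCoboundary (A B : MulAut Γ) (v : Γ) : Γ × Γ :=
  (v * (A v)⁻¹, v * (B v)⁻¹)

theorem twistedCommutator_twistedCoboundary {A B : MulAut Γ} (hAB : Commute A B) (v : Γ) :
    twistedCommutator A B (twistedCoboundary A B v) = 1 := by
  have h : A (B v) = B (A v) := DFunLike.congr_fun hAB.eq v
  simp only [twistedCommutator, twistedCoboundary, map_mul, map_inv, h]
  group

theorem two_mul_card_twistedCommutator_eq_one [Fintype Γ] (A B : MulAut Γ) :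
    2 * (Nat.card {p // twistedCommutator A B p = 1} : ℤ) =
      ∑ p, centralSign (twistedCommutator A B p) ^ 2 +
        ∑ p, centralSign (twistedCommutator A B p) := by
  classical
  simp only [← Finset.sum_add_distrib, centralSign_sq_add_centralSign]
  rw [← Finset.sum_filter, Finset.sum_const, nsmul_eq_mul, mul_comm, Nat.card_eq_fintype_card,
    Fintype.card_subtype]

end TwistedCommutator

namespace IsWeaklyExtraSpecial

variable {Γ : Type*} [Group Γ]

/-- The polarization of the function `p ↦ centralSign (twistedCommutator A B p)`. -/
noncomputable def twistedPairing (hΓ : IsWeaklyExtraSpecial Γ) (A B : MulAut Γ) :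
    Γ × Γ →* Γ × Γ →* ℤ where
  toFun p := (hΓ.commutatorPairing (A p.2)).coprod (hΓ.commutatorPairing (B p.1))
  map_one' := by ext; simp
  map_mul' p q := by
    ext r
    simp only [Prod.fst_mul, Prod.snd_mul, map_mul, MonoidHom.coprod_apply, MonoidHom.mul_apply]
    ring

theorem twistedPairing_apply (hΓ : IsWeaklyExtraSpecial Γ) (A B : MulAut Γ) (p q : Γ × Γ) :
    hΓ.twistedPairing A B p q =
      hΓ.commutatorPairing (A p.2) q.1 * hΓ.commutatorPairing (B p.1) q.2 :=
  rfl

theorem ker_flip_twistedPairing (hΓ : IsWeaklyExtraSpecial Γ) (A B : MulAut Γ) :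
    (hΓ.twistedPairing A B).flip.ker = (Subgroup.center Γ).prod (Subgroup.center Γ) := by
  ext ⟨u, w⟩
  simp only [Subgroup.mem_prod, ← hΓ.ker_commutatorPairing, MonoidHom.mem_ker, DFunLike.ext_iff,
    MonoidHom.flip_apply, twistedPairing_apply, MonoidHom.one_apply, Prod.forall]
  refine ⟨fun h => ⟨fun y => ?_, fun x => ?_⟩, fun ⟨hu, hw⟩ x y => ?_⟩
  · simpa [hΓ.commutatorPairing_comm u] using h 1 (A.symm y)
  · simpa [hΓ.commutatorPairing_comm w] using h (B.symm x) 1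
  · rw [hΓ.commutatorPairing_comm (A y), hΓ.commutatorPairing_comm (B x), hu, hw, mul_one]

theorem centralSign_twistedCommutator_mul (hΓ : IsWeaklyExtraSpecial Γ) (A B : MulAut Γ)
    (p q : Γ × Γ) :
    centralSign (twistedCommutator A B p) * centralSign (twistedCommutator A B (p * q)) =
      centralSign (twistedCommutator A B p) ^ 2 *
        (centralSign (twistedCommutator A B q) * hΓ.twistedPairing A B p q) := by
  obtain ⟨x, y⟩ := p
  obtain ⟨u, w⟩ := q
  have hsplit : twistedCommutator A B (x, y) = x * A y * ((B x)⁻¹ * y⁻¹) := by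
    rw [twistedCommutator, mul_inv_rev]
  have hexpand : twistedCommutator A B ((x, y) * (u, w)) =
      x * (u * A y) * (A w * (B u)⁻¹ * ((B x)⁻¹ * w⁻¹) * y⁻¹) := by
    simp only [twistedCommutator, Prod.mk_mul_mk, map_mul]
    group
  have swap_left : centralSign (twistedCommutator A B ((x, y) * (u, w))) =
      hΓ.commutatorPairing (A y) u *
        centralSign (x * A y * (u * A w * (B u)⁻¹) * ((B x)⁻¹ * w⁻¹) * y⁻¹) := by
    rw [hexpand, hΓ.centralSign_mul_swap, hΓ.commutatorPairing_comm]
    simp only [mul_assoc]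
  have swap_right :
      centralSign (x * A y * (u * A w * (B u)⁻¹) * ((B x)⁻¹ * w⁻¹) * y⁻¹) =
        hΓ.commutatorPairing (B x) w *
          centralSign (x * A y * twistedCommutator A B (u, w) * ((B x)⁻¹ * y⁻¹)) := by
    rw [hΓ.centralSign_mul_swap, map_inv_int, hΓ.commutatorPairing_comm, map_inv_int,
      hΓ.commutatorPairing_comm]
    simp only [twistedCommutator, mul_inv_rev, mul_assoc]
  rw [swap_left, swap_right, twistedPairing_apply, hsplit]
  linear_combination (hΓ.commutatorPairing (A y) u * hΓ.commutatorPairing (B x) w) *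
    centralSign_mul_mul_mul hΓ.card_center (x * A y) (twistedCommutator A B (u, w))
      ((B x)⁻¹ * y⁻¹)

theorem commutatorPairing_twistedCommutator (hΓ : IsWeaklyExtraSpecial Γ) (A B : MulAut Γ)
    (p : Γ × Γ) (v : Γ) :
    hΓ.commutatorPairing (twistedCommutator A B p) v =
      hΓ.twistedPairing A B p (twistedCoboundary A B v) := by
  calc hΓ.commutatorPairing (twistedCommutator A B p) v
      = hΓ.commutatorPairing v p.1 * hΓ.commutatorPairing v (A p.2) *
          (hΓ.commutatorPairing v p.2 * hΓ.commutatorPairing v (B p.1)) := by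
        rw [hΓ.commutatorPairing_comm, twistedCommutator]
        simp only [map_mul, map_inv_int]
    _ = hΓ.commutatorPairing (A p.2) (v * (A v)⁻¹) *
          hΓ.commutatorPairing (B p.1) (v * (B v)⁻¹) := by
        simp only [map_mul, map_inv_int, hΓ.commutatorPairing_map, hΓ.commutatorPairing_comm v]
        ring

theorem sum_twistedPairing_twistedCoboundary [Fintype Γ] (hΓ : IsWeaklyExtraSpecial Γ)
    (A B : MulAut Γ) (p : Γ × Γ) :
    ∑ v, hΓ.twistedPairing A B p (twistedCoboundary A B v) =
      Fintype.card Γ * centralSign (twistedCommutator A B p) ^ 2 := by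
  simp only [← commutatorPairing_twistedCommutator, sum_commutatorPairing]

theorem centralSign_twistedCommutator_twistedCoboundary_mul (hΓ : IsWeaklyExtraSpecial Γ)
    {A B : MulAut Γ} (hAB : Commute A B) (v : Γ) {r : Γ × Γ}
    (hr : r ∈ (hΓ.twistedPairing A B).flip.ker) :
    centralSign (twistedCommutator A B (twistedCoboundary A B v * r)) = 1 := by
  have h_central : twistedCommutator A B r = 1 := by
    obtain ⟨hu, hw⟩ := Subgroup.mem_prod.mp (hΓ.ker_flip_twistedPairing A B ▸ hr)
    rw [twistedCommutator, map_eq_of_mem_center hΓ.card_center A hw,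
      map_eq_of_mem_center hΓ.card_center B hu, mul_inv_eq_one]
    exact Subgroup.mem_center_iff.mp hw r.1
  have h_pairing : hΓ.twistedPairing A B (twistedCoboundary A B v) r = 1 :=
    DFunLike.congr_fun (MonoidHom.mem_ker.mp hr) _
  simpa only [twistedCommutator_twistedCoboundary hAB, h_central, h_pairing, centralSign_one,
    one_mul, one_pow] using
    hΓ.centralSign_twistedCommutator_mul A B (twistedCoboundary A B v) r

theorem sq_sum_centralSign_twistedCommutator [Fintype Γ] (hΓ : IsWeaklyExtraSpecial Γ)
    {A B : MulAut Γ} (hAB : Commute A B) :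
    (∑ p, centralSign (twistedCommutator A B p)) ^ 2 = (2 * Fintype.card Γ : ℤ) ^ 2 := by
  have card_ker : Nat.card (hΓ.twistedPairing A B).flip.ker = 4 := by
    rw [ker_flip_twistedPairing, Nat.card_congr (Subgroup.prodEquiv _ _).toEquiv, Nat.card_prod,
      hΓ.card_center]
  rw [sq_sum_of_quadratic (hΓ.twistedPairing A B) (hΓ.centralSign_twistedCommutator_mul A B)
    (fun p => (hΓ.sum_twistedPairing_twistedCoboundary A B p).symm)
    fun v _ => hΓ.centralSign_twistedCommutator_twistedCoboundary_mul hAB v,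
    card_ker, Fintype.card_prod]
  push_cast
  ring

theorem commutatorChar_mem_fixedChars_iff (hΓ : IsWeaklyExtraSpecial Γ) (A : MulAut Γ) (v : Γ) :
    hΓ.commutatorChar v ∈ fixedChars A ↔ v * (A v)⁻¹ ∈ Subgroup.center Γ := by
  have h_map (x : Γ) : hΓ.commutatorChar (A v) (A x) = hΓ.commutatorChar v x :=
    Units.ext (congrArg (Int.cast (R := ℂ)) (hΓ.commutatorPairing_map A v x))
  rw [← hΓ.ker_commutatorChar, MonoidHom.mem_ker, map_mul, map_inv, mul_inv_eq_one]
  calc hΓ.commutatorChar v ∈ fixedChars A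
      ↔ ∀ x, hΓ.commutatorChar v (A x) = hΓ.commutatorChar (A v) (A x) := by
        simp only [h_map]
        exact mem_fixedChars_iff.trans DFunLike.ext_iff
    _ ↔ hΓ.commutatorChar v = hΓ.commutatorChar (A v) :=
        A.surjective.forall.symm.trans DFunLike.ext_iff.symm

theorem card_flip_twistedPairing_twistedCoboundary_eq_one [Finite Γ]
    (hΓ : IsWeaklyExtraSpecial Γ) (hna : Subgroup.center Γ ≠ ⊤) (A B : MulAut Γ) :
    Nat.card {v // (hΓ.twistedPairing A B).flip (twistedCoboundary A B v) = 1} =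
      2 * Nat.card (fixedChars A ⊓ fixedChars B : Subgroup (Γ →* ℂˣ)) := by
  have h_iff (v : Γ) : (hΓ.twistedPairing A B).flip (twistedCoboundary A B v) = 1 ↔
      v ∈ (fixedChars A ⊓ fixedChars B).comap hΓ.commutatorChar := by
    rw [← MonoidHom.mem_ker, ker_flip_twistedPairing, Subgroup.mem_prod, Subgroup.mem_comap,
      Subgroup.mem_inf, commutatorChar_mem_fixedChars_iff, commutatorChar_mem_fixedChars_iff]
    rfl
  rw [Nat.card_congr (Equiv.subtypeEquivRight h_iff), ← hΓ.card_center, ← hΓ.ker_commutatorChar]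
  exact card_comap_of_surjective (hΓ.commutatorChar_surjective hna) _

theorem sum_centralSign_twistedCommutator_sq [Fintype Γ] (hΓ : IsWeaklyExtraSpecial Γ)
    (hna : Subgroup.center Γ ≠ ⊤) (A B : MulAut Γ) :
    ∑ p, centralSign (twistedCommutator A B p) ^ 2 =
      2 * Fintype.card Γ * Nat.card (fixedChars A ⊓ fixedChars B : Subgroup (Γ →* ℂˣ)) := by
  have card_ne_zero : (Fintype.card Γ : ℤ) ≠ 0 := Nat.cast_ne_zero.mpr Fintype.card_ne_zero
  refine mul_left_cancel₀ card_ne_zero ?_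
  rw [Finset.mul_sum, Finset.sum_congr rfl fun p _ =>
    (hΓ.sum_twistedPairing_twistedCoboundary A B p).symm, sum_sum_pairing_eq_card_mul_card,
    hΓ.card_flip_twistedPairing_twistedCoboundary_eq_one hna,
    Fintype.card_prod]
  push_cast
  ring

theorem card_twistedCommutator_eq_one [Finite Γ] (hΓ : IsWeaklyExtraSpecial Γ)
    (hna : Subgroup.center Γ ≠ ⊤) {A B : MulAut Γ} (hAB : Commute A B) {n : ℕ}
    (hn : Nat.card (fixedChars A ⊓ fixedChars B : Subgroup (Γ →* ℂˣ)) = n) :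
    (Nat.card {p // twistedCommutator A B p = 1} : ℤ) = Nat.card Γ * (n + 1) ∨
      (Nat.card {p // twistedCommutator A B p = 1} : ℤ) = Nat.card Γ * (n - 1) := by
  have := Fintype.ofFinite Γ
  have hcount := two_mul_card_twistedCommutator_eq_one A B
  rw [hΓ.sum_centralSign_twistedCommutator_sq hna, hn] at hcount
  rw [Nat.card_eq_fintype_card (α := Γ)]
  rcases sq_eq_sq_iff_eq_or_eq_neg.mp (hΓ.sq_sum_centralSign_twistedCommutator hAB) with h | h
  · exact .inl (by linarith)
  · exact .inr (by linarith)

end IsWeaklyExtraSpecial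

theorem IsExtraSpecial.isWeaklyExtraSpecial {Γ : Type*} [Group Γ] (hΓ : IsExtraSpecial 2 Γ) :
    IsWeaklyExtraSpecial Γ where
  card_center := by
    obtain ⟨e⟩ := hΓ.center_equiv
    rw [Nat.card_congr e.toEquiv]
    exact Nat.card_zmod 2
  commutatorElement_mem_center x y := by
    obtain ⟨m, ⟨f⟩⟩ := hΓ.quotient_equiv
    rw [← QuotientGroup.eq_one_iff]
    apply f.injective
    rw [map_one, ← QuotientGroup.mk'_apply, map_commutatorElement, map_commutatorElement,
      commutatorElement_eq_one_iff_mul_comm, mul_comm]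

section Extension

variable {Γ : Type*} {G' : Type*} {G : Type*} [Group Γ] [Group G'] [Group G]
  (S : GroupExtension Γ G' G)

theorem conjChar_mul (a b : G') (χ : Γ →* ℂˣ) :
    S.conjChar (a * b) χ = S.conjChar b (S.conjChar a χ) := by
  ext γ
  simp [GroupExtension.conjChar]

theorem conjChar_one (χ : Γ →* ℂˣ) : S.conjChar 1 χ = χ := by
  ext γ
  simp [GroupExtension.conjChar]

/-- The stabilizer in `G'` of a one-dimensional representation of `Γ`. -/
def charStabilizer (χ : Γ →* ℂˣ) : Subgroup G' where
  carrier := {a | S.conjChar a χ = χ}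
  one_mem' := conjChar_one S χ
  mul_mem' {a b} ha hb := by
    rw [Set.mem_ofPred_eq] at ha hb ⊢
    rw [conjChar_mul, ha, hb]
  inv_mem' {a} ha := by
    rw [Set.mem_ofPred_eq] at ha ⊢
    nth_rewrite 1 [← ha]
    rw [← conjChar_mul, mul_inv_cancel, conjChar_one]

theorem forall_mem_closure_conjChar_eq_iff (a b : G') (χ : Γ →* ℂˣ) :
    (∀ c, S.rightHom c ∈ Subgroup.closure {S.rightHom a, S.rightHom b} → S.conjChar c χ = χ) ↔
      S.conjChar a χ = χ ∧ S.conjChar b χ = χ := by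
  refine ⟨fun h => ⟨h a (Subgroup.subset_closure (by simp)),
    h b (Subgroup.subset_closure (by simp))⟩, fun ⟨ha, hb⟩ c hc => ?_⟩
  have closure_le : Subgroup.closure {S.rightHom a, S.rightHom b} ≤
      (charStabilizer S χ).map S.rightHom := by
    rw [Subgroup.closure_le]
    rintro g (rfl | rfl)
    · exact ⟨a, ha, rfl⟩
    · exact ⟨b, hb, rfl⟩
  obtain ⟨d, hd, hdc⟩ := closure_le hc
  rw [S.conjChar_eq_of_rightHom_eq hdc.symm]
  exact hd

theorem insert_one_fixedNontrivialChars (a b : G') :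
    insert 1 (S.fixedNontrivialChars (Subgroup.closure {S.rightHom a, S.rightHom b})) =
      (fixedChars (S.conjAct a) ⊓ fixedChars (S.conjAct b) : Subgroup (Γ →* ℂˣ)) := by
  ext χ
  rw [SetLike.mem_coe, Set.mem_insert_iff, GroupExtension.fixedNontrivialChars,
    Set.mem_ofPred_eq, forall_mem_closure_conjChar_eq_iff]
  change χ = 1 ∨ χ ≠ 1 ∧ χ ∈ fixedChars (S.conjAct a) ⊓ fixedChars (S.conjAct b) ↔ _
  rw [or_and_left, and_iff_right (em _), or_iff_right_of_imp]
  rintro rfl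
  exact one_mem _

theorem inl_mul_commute_iff {a b : G'} (hab : Commute a b) (p : Γ × Γ) :
    Commute (S.inl p.1 * a) (S.inl p.2 * b) ↔
      twistedCommutator (S.conjAct a) (S.conjAct b) p = 1 := by
  have mul_eq (x y : Γ) (c d : G') :
      S.inl x * c * (S.inl y * d) = S.inl (x * S.conjAct c y) * (c * d) := by
    rw [map_mul, S.inl_conjAct_comm]
    group
  rw [commute_iff_eq, mul_eq, mul_eq, hab.eq, mul_left_inj, S.inl_injective.eq_iff,
    twistedCommutator, mul_inv_eq_one]

theorem exists_inl_mul_eq {a c : G'} (h : S.rightHom c = S.rightHom a) :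
    ∃ x, S.inl x * a = c := by
  have hmem : c * a⁻¹ ∈ S.inl.range := by
    rw [S.range_inl_eq_ker_rightHom, MonoidHom.mem_ker, map_mul, map_inv, h, mul_inv_cancel]
  obtain ⟨x, hx⟩ := hmem
  exact ⟨x, by rw [hx, inv_mul_cancel_right]⟩

theorem commutingLifts_eq_image {a b : G'} (hab : Commute a b) :
    S.commutingLifts (S.rightHom a) (S.rightHom b) =
      (fun p : Γ × Γ => (S.inl p.1 * a, S.inl p.2 * b)) ''
        {p | twistedCommutator (S.conjAct a) (S.conjAct b) p = 1} := by
  ext ⟨c, d⟩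
  constructor
  · rintro ⟨hc, hd, hcd⟩
    obtain ⟨x, rfl⟩ := exists_inl_mul_eq S hc
    obtain ⟨y, rfl⟩ := exists_inl_mul_eq S hd
    exact ⟨(x, y), (inl_mul_commute_iff S hab (x, y)).mp hcd, rfl⟩
  · rintro ⟨p, hp, hcd⟩
    obtain ⟨rfl, rfl⟩ := Prod.mk.inj hcd
    exact ⟨by simp, by simp, ((inl_mul_commute_iff S hab p).mpr hp).eq⟩

theorem finite_commutingLifts [Finite Γ] (α β : G) : (S.commutingLifts α β).Finite := by
  rcases (S.commutingLifts α β).eq_empty_or_nonempty with h | ⟨⟨a, b⟩, rfl, rfl, hab⟩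
  · exact h ▸ Set.finite_empty
  · rw [commutingLifts_eq_image S hab]
    exact Set.toFinite _

theorem ncard_commutingLifts {a b : G'} (hab : Commute a b) :
    (S.commutingLifts (S.rightHom a) (S.rightHom b)).ncard =
      Nat.card {p // twistedCommutator (S.conjAct a) (S.conjAct b) p = 1} := by
  rw [commutingLifts_eq_image S hab]
  refine Set.ncard_image_of_injective _ fun p q hpq => Prod.ext ?_ ?_
  · exact S.inl_injective (mul_right_cancel (Prod.mk.inj hpq).1)
  · exact S.inl_injective (mul_right_cancel (Prod.mk.inj hpq).2)

theorem card_fixedChars_inf_fixedChars [Finite (Γ →* ℂˣ)] (a b : G') :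
    Nat.card (fixedChars (S.conjAct a) ⊓ fixedChars (S.conjAct b) : Subgroup (Γ →* ℂˣ)) =
      (S.fixedNontrivialChars (Subgroup.closure {S.rightHom a, S.rightHom b})).ncard + 1 := by
  rw [← SetLike.coe_sort_coe, Nat.card_coe_set_eq, ← insert_one_fixedNontrivialChars,
    Set.ncard_insert_of_notMem fun h => h.1 rfl]

end Extension

theorem mainTheorem6 {Γ : Type u} {G' : Type v} {G : Type w} [Group Γ] [Group G'] [Group G]
    (r : ℕ) (hr : 1 ≤ r) (hΓ : IsExtraSpecial 2 Γ) (hcard : Nat.card Γ = 2 ^ (2 * r + 1))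
    (S : GroupExtension Γ G' G) (α β : G) (hαβ : α * β = β * α)
    (N : ℕ) (hN : N = (S.fixedNontrivialChars (Subgroup.closure {α, β})).ncard) :
    (S.fixedNontrivialChars (Subgroup.closure {α, β})).Finite ∧
    (S.commutingLifts α β).Finite ∧
    ((S.commutingLifts α β).ncard = 0 ∨
      ((S.commutingLifts α β).ncard : ℤ) = 2 ^ (2 * r + 1) * (1 + (N : ℤ) + 1) ∨
      ((S.commutingLifts α β).ncard : ℤ) = 2 ^ (2 * r + 1) * (1 + (N : ℤ) - 1)) := by
  have := hΓ.finite
  have hΓ₂ := hΓ.isWeaklyExtraSpecial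
  have hna : Subgroup.center Γ ≠ ⊤ := hΓ₂.center_ne_top <| by
    rw [hcard]
    exact (lt_self_pow₀ one_lt_two (by omega)).ne'
  have := Finite.of_surjective _ (hΓ₂.commutatorChar_surjective hna)
  refine ⟨Set.toFinite _, finite_commutingLifts S α β, ?_⟩
  rcases (S.commutingLifts α β).eq_empty_or_nonempty with h | ⟨⟨a, b⟩, rfl, rfl, hab⟩
  · exact .inl (h ▸ Set.ncard_empty _)
  · have card_fixedChars := card_fixedChars_inf_fixedChars S a b
    rw [← hN] at card_fixedChars
    have h := hΓ₂.card_twistedCommutator_eq_one hna (Commute.map hab S.conjAct) card_fixedChars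
    rw [← ncard_commutingLifts S hab, hcard] at h
    push_cast at h
    rw [add_comm (1 : ℤ)]
    exact .inr h
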